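/- Let $X$ be a finite set of signals, let $X^*$ be the set of all nonempty subsets of $X$, let $\Omega=\{1,\dots,n\}$ be a finite set of states and let $\Delta(\Omega)\subset\mathbb{R}^n$ be the set of probability distributions on $\Omega$. For $d\in\Delta(\Omega)$ and $B\subseteq\Omega$ write $d(B)=\sum_{\omega\in B}d(\omega)$. A belief formation process is a map $f:X^*\to\Delta(\Omega)$. The process $f$ is strongly rich if for every $x\in X$ there are $y,z\in X$ such that $f(\{x\}),f(\{y\}),f(\{z\})$ do not lie on one line, $f(\{x,y\})\notin\{f(\{x\}),f(\{y\})\}$ and $f(\{x,z\})\notin\{f(\{x\}),f(\{z\})\}$. It satisfies the weighted averaging axiom if for all disjoint $A,B\in X^*$ there is $\lambda\in[0,1]$ (which may depend on $A$ and $B$) with $f(A\cup B)=\lambda f(A)+(1-\lambda)f(B)$. A conditional probability system is a family $(P_A)_{A\in X^*}$ of probability measures on $(\Omega\times X,2^{\Omega\times X})$ such that $P_A(\Omega\times A)=1$ for every $A\in X^*$, and $$P_{A_1\cup A_2}(C)=P_{A_1\cup A_2}(\Omega\times A_1)\,P_{A_1}(C)+P_{A_1\cup A_2}(\Omega\times A_2)\,P_{A_2}(C)$$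 for all disjoint $A_1,A_2\in X^*$ and all $C\subseteq\Omega\times X$. The process $f$ is rationalizable by a conditional probability system if there is such a system with $(f(A))(B)=P_A(B\times A)$ for all $A\in X^*$ and $B\subseteq\Omega$. Proposition. A strongly rich belief formation process is rationalizable by a conditional probability system if and only if it satisfies the weighted averaging axiom. -/

import Mathlib

open MeasureTheory

/-- `X*`: the set of all nonempty finite subsets of `X`. -/
abbrev NonemptyFinset (X : Type*) : Type _ := {A : Finset X // A.Nonempty}

namespace NonemptyFinset

variable {X : Type*}

/-- The one-element set `{x}` in `X*`. -/
def single (x : X) : NonemptyFinset X := ⟨{x}, Finset.singleton_nonempty x⟩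

/-- The union `A ∪ B` in `X*`. -/
def union [DecidableEq X] (A B : NonemptyFinset X) : NonemptyFinset X :=
  ⟨A.1 ∪ B.1, A.2.mono Finset.subset_union_left⟩

/-- The set `{x, y}` in `X*`. -/
def pair [DecidableEq X] (x y : X) : NonemptyFinset X :=
  ⟨{x, y}, Finset.insert_nonempty x {y}⟩

end NonemptyFinset

/-- An aggregation rule on `X` with values in a real vector space `H`. -/
abbrev AggregationRule (X H : Type*) : Type _ := NonemptyFinset X → H

namespace AggregationRule

variable {X H : Type*} [DecidableEq X] [AddCommGroup H] [Module ℝ H]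

/-- The weighted averaging axiom: for disjoint `A, B ∈ X*`, the value `f (A ∪ B)` is
`l • f A + (1 - l) • f B` for some `l ∈ [0, 1]`, which may depend on `A` and `B`. -/
def WeightedAveraging (f : AggregationRule X H) : Prop :=
  ∀ A B : NonemptyFinset X, Disjoint A.1 B.1 →
    ∃ l : ℝ, l ∈ Set.Icc (0 : ℝ) 1 ∧ f (.union A B) = l • f A + (1 - l) • f B

/-- Strong richness: for every `x` there are `y, z` such that `f {x}, f {y}, f {z}` are not on one
line, `f {x, y} ∉ {f {x}, f {y}}` and `f {x, z} ∉ {f {x}, f {z}}`. -/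
def StronglyRich (f : AggregationRule X H) : Prop :=
  ∀ x : X, ∃ y z : X,
    ¬ Collinear ℝ ({f (.single x), f (.single y), f (.single z)} : Set H) ∧
    f (.pair x y) ∉ ({f (.single x), f (.single y)} : Set H) ∧
    f (.pair x z) ∉ ({f (.single x), f (.single z)} : Set H)

end AggregationRule

/-- A belief formation process on `X` with `n` states of nature: a map from `X*` to the set `Δ(Ω)`
of probability vectors on `Ω = Fin n`. -/
abbrev BeliefFormationProcess (X : Type*) (n : ℕ) : Type _ :=
  NonemptyFinset X → stdSimplex ℝ (Fin n)

namespace BeliefFormationProcess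

variable {X : Type*} {n : ℕ}

/-- A belief formation process seen as an aggregation rule with values in `ℝⁿ`. -/
def toAggregationRule (f : BeliefFormationProcess X n) : AggregationRule X (Fin n → ℝ) :=
  fun A => (f A).1

/-- The probability `(f A)(B) = ∑ ω ∈ B, (f A)(ω)` that the belief `f A` gives to `B ⊆ Ω`. -/
def prob (f : BeliefFormationProcess X n) (A : NonemptyFinset X) (B : Finset (Fin n)) : ℝ :=
  ∑ ω ∈ B, f.toAggregationRule A ω

end BeliefFormationProcess

/-- A conditional probability system: a family `P A`, `A ∈ X*`, of probability measures on `Ω × X`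
with `P A (Ω × A) = 1`, satisfying Bayes' rule
`P (A₁ ∪ A₂) C = P (A₁ ∪ A₂) (Ω × A₁) * P A₁ C + P (A₁ ∪ A₂) (Ω × A₂) * P A₂ C`
for all disjoint `A₁, A₂ ∈ X*` and all `C ⊆ Ω × X`. It is used with finite discrete `X`, so that
every subset of `Ω × X` is measurable. -/
structure IsConditionalProbabilitySystem {X : Type*} [DecidableEq X] [MeasurableSpace X] {n : ℕ}
    (P : NonemptyFinset X → Measure (Fin n × X)) : Prop where
  isProbabilityMeasure : ∀ A, IsProbabilityMeasure (P A)
  support : ∀ A, P A (Set.univ ×ˢ (A.1 : Set X)) = 1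
  bayes : ∀ A₁ A₂ : NonemptyFinset X, Disjoint A₁.1 A₂.1 → ∀ C : Set (Fin n × X),
    P (.union A₁ A₂) C =
      P (.union A₁ A₂) (Set.univ ×ˢ (A₁.1 : Set X)) * P A₁ C +
        P (.union A₁ A₂) (Set.univ ×ˢ (A₂.1 : Set X)) * P A₂ C

/-- `f` is rationalizable by a conditional probability system: for some such system `P`,
`(f A)(B) = P A (B × A)` for all `A ∈ X*` and `B ⊆ Ω`. -/
def BeliefFormationProcess.RationalizableByCPS {X : Type*} [DecidableEq X] [MeasurableSpace X]
    {n : ℕ} (f : BeliefFormationProcess X n) : Prop :=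
  ∃ P : NonemptyFinset X → Measure (Fin n × X), IsConditionalProbabilitySystem P ∧
    ∀ (A : NonemptyFinset X) (B : Finset (Fin n)),
      f.prob A B = (P A).real ((B : Set (Fin n)) ×ˢ (A.1 : Set X))

/-! For a conditional probability system, `f A` is the marginal of `P A` on states, and Bayes' rule
for sets of the form `{ω} × X` is weighted averaging with `λ = P (A ∪ B) (Ω × A)`.

For the converse it suffices to find a ranking of the signals and positive weights `w` such that `f
A` is the `w`-weighted mean of the singleton beliefs over the top ranked elements of `A`
(`lexMean`). The point masses `lexWeight A x * f {x} ω` then form the required system.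

Pairs determine relative weights wherever `f {x} ≠ f {y}`. On a triangle, the three ways to split
off a vertex force Ceva's identity (`IsPairWeight.cocycle`). Strong richness supplies, off every
line through `f {x}`, a signal tied with `x`, that is, with both weights nonzero. With this signal
as the apex of a tetrahedron, `cocycle_of_faces` carries the identity over to coincident and
collinear points (`exists_cocycle_extension`). A global cocycle amounts to ranks and ratios of
weights (`exists_rank_weight`). Finally, `FinsetWeightedAveraging.eq_lexMean` shows by induction
that pairs determine all other values, because two nonparallel lines meet in at most one point; tied
signals off a given line provide the second line. -/

/-! ### Affine geometry of triangles -/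

section Noncollinear

variable {H : Type*} [AddCommGroup H] [Module ℝ H]

/-- Affine independence of three points, in barycentric form. -/
def Noncollinear (a b c : H) : Prop :=
  ∀ α β γ : ℝ, α + β + γ = 0 → α • a + β • b + γ • c = 0 → α = 0 ∧ β = 0 ∧ γ = 0

namespace Noncollinear

variable {a b c t : H}

theorem rotate (h : Noncollinear a b c) : Noncollinear b c a := by
  intro α β γ h0 h1
  obtain ⟨h2, h3, h4⟩ := h γ α β (by linarith) (by rw [← h1]; abel)
  exact ⟨h3, h4, h2⟩

theorem swap (h : Noncollinear a b c) : Noncollinear b a c := by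
  intro α β γ h0 h1
  obtain ⟨h2, h3, h4⟩ := h β α γ (by linarith) (by rw [← h1]; abel)
  exact ⟨h3, h2, h4⟩

theorem ne (h : Noncollinear a b c) : a ≠ b := by
  rintro rfl
  have := h 1 (-1) 0 (by norm_num) (by module)
  norm_num at this

/-- Equal affine combinations of affinely independent points have equal coefficients. -/
theorem coeff_eq (h : Noncollinear a b c) {α β γ α' β' γ' : ℝ}
    (hs : α + β + γ = α' + β' + γ')
    (he : α • a + β • b + γ • c = α' • a + β' • b + γ' • c) : α = α' ∧ β = β' ∧ γ = γ' := by
  obtain ⟨h1, h2, h3⟩ := h (α - α') (β - β') (γ - γ') (by linarith)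
    (by linear_combination (norm := module) he)
  exact ⟨by linarith, by linarith, by linarith⟩

theorem of_not_collinear (h : ¬ Collinear ℝ ({a, b, c} : Set H)) : Noncollinear a b c := by
  intro α β γ h0 h1
  have hα : α = -(β + γ) := by linarith
  have key : β • (b - a) + γ • (c - a) = 0 := by
    rw [← h1, hα]; module
  have hβ : β = 0 := by
    by_contra hβ
    apply h
    rw [collinear_iff_of_mem (p₀ := a) (by simp)]
    refine ⟨c - a, ?_⟩
    have hb : b = (-(β⁻¹ * γ)) • (c - a) + a := by
      have h2 : β⁻¹ • (β • (b - a) + γ • (c - a)) = 0 := by rw [key, smul_zero]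
      rw [smul_add, smul_smul, inv_mul_cancel₀ hβ, smul_smul] at h2
      linear_combination (norm := module) h2
    simp only [Set.mem_insert_iff, Set.mem_singleton_iff, vadd_eq_add]
    rintro p (rfl | rfl | rfl)
    · exact ⟨0, by simp⟩
    · exact ⟨_, hb⟩
    · exact ⟨1, by simp⟩
  have hγ : γ = 0 := by
    by_contra hγ
    apply h
    have hc : c = a := by
      rw [hβ, zero_smul, zero_add, smul_eq_zero] at key
      exact sub_eq_zero.1 (key.resolve_left hγ)
    rw [hc]
    simpa [Set.pair_comm, Set.insert_comm] using collinear_pair ℝ a b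
  exact ⟨by rw [hα, hβ, hγ]; simp, hβ, hγ⟩

/-- A point on a line through two points, other than the first, spans the same line with it. -/
theorem of_mem_line (h : Noncollinear a b t) (hac : a ≠ c) (hn : ¬ Noncollinear a b c) :
    Noncollinear a c t := by
  simp only [Noncollinear, not_forall] at hn
  obtain ⟨α, β, γ, h0, h1, h2⟩ := hn
  have hβ : β ≠ 0 := by
    rintro rfl
    have : α • (a - c) = 0 := by
      rw [← h1, show γ = -α by linarith]; module
    rcases smul_eq_zero.1 this with h | h
    · exact h2 ⟨h, rfl, by linarith⟩
    · exact hac (sub_eq_zero.1 h)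
  intro α' γ' δ h3 h4
  -- Eliminating `c` between the two relations leaves a relation among `a`, `b`, `t`.
  obtain ⟨h5, h6, h7⟩ := h (α' * γ - γ' * α) (-(γ' * β)) (δ * γ)
    (by linear_combination γ * h3 - γ' * h0) (by linear_combination (norm := module) γ • h4 - γ' • h1)
  have hγ' : γ' = 0 := by
    simpa [hβ] using h6
  have hγ : γ ≠ 0 := by
    rintro rfl
    have : β • (b - a) = 0 := by
      rw [← h1, show α = -β by linarith]; module
    rcases smul_eq_zero.1 this with h' | h'
    · exact hβ h'
    · exact h.ne (sub_eq_zero.1 h').symm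
  have hδ : δ = 0 := by simpa [hγ] using h7
  exact ⟨by linarith, hγ', hδ⟩

/-- A line through a vertex of a triangle misses one of the other two vertices. -/
theorem off_line (h : Noncollinear a b c) (hat : a ≠ t) :
    Noncollinear a t b ∨ Noncollinear a t c := by
  by_cases h1 : Noncollinear a b t
  · exact Or.inl h1.swap.rotate
  · exact Or.inr (h.of_mem_line hat h1)

end Noncollinear

end Noncollinear

/-! ### The cocycle identity on a tetrahedron -/

section Cocycle

/-- The multiplicative cocycle identity of pairwise weights on a triple. -/
def Cocycle {X : Type*} (l : X → X → ℝ) (x y z : X) : Prop :=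
  l x y * l y z * l z x = l y x * l z y * l x z

namespace Cocycle

variable {X : Type*} {l : X → X → ℝ} {x y z : X}

theorem rotate (h : Cocycle l x y z) : Cocycle l y z x := by
  unfold Cocycle at *
  linear_combination h

end Cocycle

/-- The cocycle identity on one face of a tetrahedron follows from the identity on the three
others, if the apex is tied with a vertex of that face. -/
theorem cocycle_of_faces {xy yx yz zy zx xz xt tx yt ty zt tz : ℝ}
    (sy : yt + ty = 1) (sz : zt + tz = 1) (hxt : xt ≠ 0) (htx : tx ≠ 0)
    (h1 : xy * yt * tx = yx * ty * xt) (h2 : yz * zt * ty = zy * tz * yt)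
    (h3 : zx * xt * tz = xz * tx * zt) : xy * yz * zx = yx * zy * xz := by
  have hy : yt = 0 ∨ ty = 0 ∨ (yt ≠ 0 ∧ ty ≠ 0) := by tauto
  have hz : zt = 0 ∨ tz = 0 ∨ (zt ≠ 0 ∧ tz ≠ 0) := by tauto
  -- If a weight on `yt` or `zt` vanishes, its opposite is 1, and the faces then force a zero factor
  -- on each side of the goal.
  rcases hz with hz | hz | ⟨hz, hz'⟩
  · have : tz = 1 := by linarith
    subst hz this
    have hzx : zx = 0 := by simpa [hxt] using h3
    have : zy * yt = 0 := by linarith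
    rcases mul_eq_zero.1 this with h | h
    · simp [hzx, h]
    · have h' : ty = 1 := by linarith
      have : yx = 0 := by simpa [hxt, h, h'] using h1.symm
      simp [hzx, this]
  · have : zt = 1 := by linarith
    subst hz this
    have hxz : xz = 0 := by simpa [htx] using h3.symm
    have : yz * ty = 0 := by linarith
    rcases mul_eq_zero.1 this with h | h
    · simp [hxz, h]
    · have h' : yt = 1 := by linarith
      have : xy = 0 := by simpa [htx, h, h'] using h1
      simp [hxz, this]
  · rcases hy with hy | hy | ⟨hy, hy'⟩
    · have : ty = 1 := by linarith
      subst hy this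
      have h4 : yx = 0 := by simpa [hxt] using h1.symm
      have h5 : yz = 0 := by simpa [hz] using h2
      simp [h4, h5]
    · have : yt = 1 := by linarith
      subst hy this
      have h4 : xy = 0 := by simpa [htx] using h1
      have h5 : zy = 0 := by simpa [hz'] using h2.symm
      simp [h4, h5]
    -- In the product of the three identities, the edges at the apex occur equally on both sides and
    -- cancel.
    · have hne : yt * ty * zt * tz * xt * tx ≠ 0 := by positivity
      apply mul_right_cancel₀ hne
      calc xy * yz * zx * (yt * ty * zt * tz * xt * tx)
          = (xy * yt * tx) * (yz * zt * ty) * (zx * xt * tz) := by ring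
        _ = (yx * ty * xt) * (zy * tz * yt) * (xz * tx * zt) := by rw [h1, h2, h3]
        _ = yx * zy * xz * (yt * ty * zt * tz * xt * tx) := by ring

end Cocycle

/-! ### Weights of pairs and Ceva's theorem -/

section PairWeights

variable {X H : Type*} [DecidableEq X] [AddCommGroup H] [Module ℝ H]

/-- The weighted averaging axiom for a map on all finite sets, whose value at `∅` is ignored. -/
def FinsetWeightedAveraging (F : Finset X → H) : Prop :=
  ∀ A B : Finset X, A.Nonempty → B.Nonempty → Disjoint A B →
    ∃ l : ℝ, 0 ≤ l ∧ l ≤ 1 ∧ F (A ∪ B) = l • F A + (1 - l) • F B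

/-- `l x y` and `l y x` are the weights of `F {x}` and `F {y}` in `F {x, y}`. -/
structure IsPairWeight (F : Finset X → H) (l : X → X → ℝ) : Prop where
  nonneg : ∀ x y, F {x} ≠ F {y} → 0 ≤ l x y
  add_swap : ∀ x y, F {x} ≠ F {y} → l x y + l y x = 1
  pair_eq : ∀ x y, F {x} ≠ F {y} → F {x, y} = l x y • F {x} + l y x • F {y}

/-- Distinct endpoints make the coefficient on a segment unique, so the weights read from both
orders of a pair sum to 1. For coincident endpoints the weight is undetermined, and 0 is a dummy
value. -/
theorem FinsetWeightedAveraging.exists_isPairWeight {F : Finset X → H}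
    (hF : FinsetWeightedAveraging F) : ∃ l, IsPairWeight F l := by
  have h : ∀ x y, ∃ l : ℝ, F {x} ≠ F {y} →
      0 ≤ l ∧ l ≤ 1 ∧ F {x, y} = l • F {x} + (1 - l) • F {y} := by
    intro x y
    by_cases hxy : F {x} = F {y}
    · exact ⟨0, fun h => absurd hxy h⟩
    · have hne : x ≠ y := fun h => hxy (by rw [h])
      obtain ⟨l, h0, h1, h2⟩ := hF {x} {y} (by simp) (by simp) (by simpa using hne)
      exact ⟨l, fun _ => ⟨h0, h1, h2⟩⟩
  choose l hl using h
  have hsum : ∀ x y, F {x} ≠ F {y} → l x y + l y x = 1 := by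
    intro x y hxy
    have h1 := (hl x y hxy).2.2
    have h2 := (hl y x hxy.symm).2.2
    rw [Finset.pair_comm, h1] at h2
    have h3 : (l x y + l y x - 1) • (F {x} - F {y}) = 0 := by
      linear_combination (norm := module) h2
    have := (smul_eq_zero.1 h3).resolve_right (sub_ne_zero.2 hxy)
    linarith
  refine ⟨l, fun x y h => (hl x y h).1, hsum, fun x y h => ?_⟩
  rw [(hl x y h).2.2, ← hsum x y h]
  congr 2
  ring

/-- Ceva's theorem: pairwise weights satisfy the cocycle identity on a triangle. -/
theorem IsPairWeight.cocycle {F : Finset X → H} {l : X → X → ℝ} (hl : IsPairWeight F l)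
    (hF : FinsetWeightedAveraging F) {x y z : X} (h : Noncollinear (F {x}) (F {y}) (F {z})) :
    Cocycle l x y z := by
  have hxy := h.ne
  have hyz := h.rotate.ne
  have hzx := h.rotate.rotate.ne
  have nxy : x ≠ y := fun h => hxy (by rw [h])
  have nyz : y ≠ z := fun h => hyz (by rw [h])
  have nzx : z ≠ x := fun h => hzx (by rw [h])
  -- The three splittings show that `α`, `β`, `γ` are the barycentric coordinates of `F {x, y, z}`.
  obtain ⟨α, -, -, h1⟩ := hF {x} {y, z} (by simp) (by simp) (by simp [nxy, nzx.symm])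
  obtain ⟨β, -, -, h2⟩ := hF {y} {z, x} (by simp) (by simp) (by simp [nyz, nxy.symm])
  obtain ⟨γ, -, -, h3⟩ := hF {z} {x, y} (by simp) (by simp) (by simp [nzx, nyz.symm])
  have e2 : ({y} ∪ {z, x} : Finset X) = {x} ∪ {y, z} := by ext; simp; tauto
  have e3 : ({z} ∪ {x, y} : Finset X) = {x} ∪ {y, z} := by ext; simp; tauto
  rw [e2, h1, hl.pair_eq y z hyz, hl.pair_eq z x hzx] at h2
  rw [e3, h1, hl.pair_eq y z hyz, hl.pair_eq x y hxy] at h3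
  have sxy := hl.add_swap x y hxy
  have syz := hl.add_swap y z hyz
  have szx := hl.add_swap z x hzx
  obtain ⟨a1, a2, a3⟩ := h.coeff_eq (α := α) (β := (1 - α) * l y z) (γ := (1 - α) * l z y)
    (α' := (1 - β) * l x z) (β' := β) (γ' := (1 - β) * l z x)
    (by linear_combination (1 - α) * syz - (1 - β) * szx)
    (by linear_combination (norm := module) h2)
  obtain ⟨b1, b2, b3⟩ := h.coeff_eq (α := α) (β := (1 - α) * l y z) (γ := (1 - α) * l z y)
    (α' := (1 - γ) * l x y) (β' := (1 - γ) * l y x) (γ' := γ)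
    (by linear_combination (1 - α) * syz - (1 - γ) * sxy)
    (by linear_combination (norm := module) h3)
  have c1 : α * l z x = γ * l x z := by
    rw [a1, ← b3, a3]; ring
  have c2 : α * l y x = β * l x y := by
    rw [b1, ← a2, b2]; ring
  have c3 : β * l z y = γ * l y z := by
    rw [← a2, ← b3]; ring
  have s : α + β + γ = 1 := by
    linear_combination - a2 - b3 + (1 - α) * syz
  unfold Cocycle
  -- Some coordinates may vanish, so nothing is divided: the defect of the identity is multiplied by
  -- `α + β + γ = 1`, and each of the three products is zero.
  linear_combination (-(l x y * l y z * l z x - l y x * l z y * l x z)) * s +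
    (l x y * l y z) * c1 - (l z y * l x z) * c2 - (l x y * l x z) * c3
    - (l y z * l z x) * c2 - (l y x * l x z) * c3 + (l y x * l y z) * c1
    - (l x y * l z x) * c3 + (l y x * l z y) * c1 - (l z x * l z y) * c2

end PairWeights

/-! ### Extending the weights to coincident points -/

section Extension

variable {X H : Type*} [AddCommGroup H] [Module ℝ H]

/-- Pairwise weights given at pairs of distinct points `a x ≠ a y` extend to all pairs, if every
`x` is tied with two signals that form a triangle with it. -/
theorem exists_cocycle_extension {a : X → H} {l : X → X → ℝ}
    (hl0 : ∀ x y, a x ≠ a y → 0 ≤ l x y) (hl1 : ∀ x y, a x ≠ a y → l x y + l y x = 1)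
    (hc : ∀ x y z, Noncollinear (a x) (a y) (a z) → Cocycle l x y z)
    (hr : ∀ x, ∃ y z, Noncollinear (a x) (a y) (a z) ∧
      (l x y ≠ 0 ∧ l y x ≠ 0) ∧ (l x z ≠ 0 ∧ l z x ≠ 0)) :
    ∃ L : X → X → ℝ, (∀ x y, 0 ≤ L x y) ∧ (∀ x y, L x y + L y x = 1) ∧
      (∀ x y, a x ≠ a y → L x y = l x y) ∧ ∀ x y z, Cocycle L x y z := by
  have hoff : ∀ x (c : H), a x ≠ c →
      ∃ t, Noncollinear (a x) c (a t) ∧ l x t ≠ 0 ∧ l t x ≠ 0 := by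
    intro x c hxc
    obtain ⟨y, z, h, hy, hz⟩ := hr x
    rcases h.off_line hxc with h | h
    · exact ⟨y, h, hy⟩
    · exact ⟨z, h, hz⟩
  have htie : ∀ x, ∃ t, a x ≠ a t ∧ l x t ≠ 0 ∧ l t x ≠ 0 := by
    intro x
    obtain ⟨y, _, h, hy, -⟩ := hr x
    exact ⟨y, h.ne, hy⟩
  -- The apex is `u` over the face `x`, `y`, `t`: the ratio `p : q` that fits `u` also fits `t`.
  have transfer : ∀ x y u t (p q : ℝ), a x = a y → Noncollinear (a x) (a u) (a t) →
      l x u ≠ 0 → l u x ≠ 0 →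
      p * l y u * l u x = q * l u y * l x u → p * l y t * l t x = q * l t y * l x t := by
    intro x y u t p q hxy h h1 h2 h3
    have hu : a y ≠ a u := hxy ▸ h.ne
    have ht : a t ≠ a u := h.rotate.ne.symm
    refine cocycle_of_faces (hl1 y u hu) (hl1 t u ht) h1 h2 h3 ?_ ?_
    · have := hc y t u (hxy ▸ h.swap.rotate)
      exact this
    · exact hc t x u h.rotate.rotate
  have hex : ∀ x y, ∃ p : ℝ, a x = a y → 0 ≤ p ∧ p ≤ 1 ∧
      ∀ t, a x ≠ a t → p * l y t * l t x = (1 - p) * l t y * l x t := by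
    intro x y
    by_cases hxy : a x = a y
    · obtain ⟨u, hu, h1, h2⟩ := htie x
      have hu' : a y ≠ a u := hxy ▸ hu
      have p1 := lt_of_le_of_ne (hl0 x u hu) h1.symm
      have p2 := lt_of_le_of_ne (hl0 u x hu.symm) h2.symm
      have p3 := hl0 y u hu'
      have p4 := hl0 u y hu'.symm
      have p5 := hl1 y u hu'
      have hpos : 0 < l y u * l u x + l u y * l x u := by
        rcases p3.eq_or_lt with h | h
        · have : l u y = 1 := by linarith
          rw [← h, this]; simpa using p1
        · positivity
      set s := l y u * l u x + l u y * l x u with hs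
      -- This value solves the cocycle identity on `x`, `y`, `u` for the unknown weight.
      refine ⟨l u y * l x u / s, fun _ => ⟨by positivity, ?_, ?_⟩⟩
      · rw [div_le_one hpos, hs]
        have : 0 ≤ l y u * l u x := by positivity
        linarith
      · have base : l u y * l x u / s * l y u * l u x =
            (1 - l u y * l x u / s) * l u y * l x u := by
          field_simp
          rw [hs]; ring
        intro t ht
        by_cases h : Noncollinear (a x) (a u) (a t)
        · exact transfer x y u t _ _ hxy h h1 h2 base
        -- When `t` is on the line through `x` and `u`, the ratio passes from `u` to `t` through a
        -- tied `v` off that line.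
        · obtain ⟨v, hv, h3, h4⟩ := hoff x (a u) hu
          have hvt := hv.of_mem_line ht h
          exact transfer x y v t _ _ hxy hvt.swap.rotate h3 h4
            (transfer x y u v _ _ hxy hv h1 h2 base)
    · exact ⟨0, fun h => absurd h hxy⟩
  choose p hp using hex
  have hp1 : ∀ x y, a x = a y → p x y + p y x = 1 := by
    intro x y hxy
    obtain ⟨u, hu, h1, h2⟩ := htie x
    have hu' : a y ≠ a u := hxy ▸ hu
    have e1 := (hp x y hxy).2.2 u hu
    have e2 := (hp y x hxy.symm).2.2 u hu'
    have p1 := lt_of_le_of_ne (hl0 x u hu) h1.symm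
    have p2 := lt_of_le_of_ne (hl0 u x hu.symm) h2.symm
    have p3 := hl0 y u hu'
    have p5 := hl1 y u hu'
    have p4 := hl0 u y hu'.symm
    have hpos : 0 < l y u * l u x + l u y * l x u := by
      rcases p3.eq_or_lt with h | h
      · have : l u y = 1 := by linarith
        rw [← h, this]; simpa using p1
      · positivity
    apply mul_right_cancel₀ hpos.ne'
    linear_combination e1 + e2
  classical
  set L : X → X → ℝ := fun x y => if a x = a y then p x y else l x y with hL
  have hLp : ∀ x y, a x = a y → L x y = p x y := fun x y h => if_pos h
  have hLl : ∀ x y, a x ≠ a y → L x y = l x y := fun x y h => if_neg h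
  have hL1 : ∀ x y, L x y + L y x = 1 := by
    intro x y
    by_cases h : a x = a y
    · rw [hLp x y h, hLp y x h.symm, hp1 x y h]
    · rw [hLl x y h, hLl y x (Ne.symm h), hl1 x y h]
  have cNC : ∀ x y z, Noncollinear (a x) (a y) (a z) → Cocycle L x y z := by
    intro x y z h
    have := hc x y z h
    unfold Cocycle at *
    rw [hLl x y h.ne, hLl y x h.ne.symm, hLl y z h.rotate.ne, hLl z y h.rotate.ne.symm,
      hLl z x h.rotate.rotate.ne, hLl x z h.rotate.rotate.ne.symm, this]
  have c2 : ∀ x y z, a x = a y → a x ≠ a z → Cocycle L x y z := by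
    intro x y z h hz
    have hz' : a y ≠ a z := h ▸ hz
    have := (hp x y h).2.2 z hz
    unfold Cocycle
    rw [hLp x y h, hLp y x h.symm, hLl y z hz', hLl z y hz'.symm, hLl z x hz.symm, hLl x z hz,
      this, ← hp1 x y h]
    ring
  have face : ∀ x y z t, Cocycle L x y t → Cocycle L y z t → Cocycle L z x t → L x t ≠ 0 →
      L t x ≠ 0 → Cocycle L x y z := fun x y z t h1 h2 h3 h4 h5 =>
    cocycle_of_faces (hL1 y t) (hL1 z t) h4 h5 h1 h2 h3
  refine ⟨L, fun x y => ?_, hL1, hLl, fun x y z => ?_⟩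
  · by_cases h : a x = a y
    · rw [hLp x y h]; exact (hp x y h).1
    · rw [hLl x y h]; exact hl0 x y h
  · by_cases hxy : a x = a y
    · by_cases hxz : a x = a z
      · obtain ⟨t, ht, h1, h2⟩ := htie x
        have hyt : a y ≠ a t := hxy ▸ ht
        have hzt : a z ≠ a t := hxz ▸ ht
        exact face x y z t (c2 x y t hxy ht) (c2 y z t (hxy ▸ hxz) hyt)
          (c2 z x t hxz.symm hzt) (by rwa [hLl x t ht]) (by rwa [hLl t x ht.symm])
      · exact c2 x y z hxy hxz
    · by_cases hyz : a y = a z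
      · exact (c2 y z x hyz (Ne.symm hxy)).rotate.rotate
      · by_cases hzx : a z = a x
        · exact (c2 z x y hzx (Ne.symm hyz)).rotate
        · by_cases h : Noncollinear (a x) (a y) (a z)
          · exact cNC x y z h
          · obtain ⟨t, ht, h1, h2⟩ := hoff x (a y) hxy
            have hzt := ht.of_mem_line (Ne.symm hzx) h
            have h' : ¬ Noncollinear (a y) (a x) (a z) := fun h' => h h'.swap
            have hyz' := ht.swap.of_mem_line hyz h'
            have hxt := hzt.rotate.rotate.ne.symm
            exact face x y z t (cNC x y t ht) (cNC y z t hyz') (cNC z x t hzt.swap)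
              (by rwa [hLl x t hxt]) (by rwa [hLl t x hxt.symm])

end Extension

/-! ### From a cocycle to ranks and weights -/

section Ranking

variable {X : Type*} [Finite X]

/-- Pairwise weights with the cocycle identity come from a ranking of the signals and positive
weights: the lower ranked signal of a pair is ignored, and signals of equal rank share in
proportion to their weights. -/
theorem exists_rank_weight {L : X → X → ℝ} (h0 : ∀ x y, 0 ≤ L x y)
    (h1 : ∀ x y, L x y + L y x = 1) (hc : ∀ x y z, Cocycle L x y z) :
    ∃ (rank : X → ℕ) (w : X → ℝ), (∀ x, 0 < w x) ∧
      (∀ x y, rank y < rank x → L x y = 1) ∧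
      ∀ x y, rank x = rank y → L x y * w y = L y x * w x := by
  classical
  have := Fintype.ofFinite X
  rcases isEmpty_or_nonempty X with hX | hX
  · exact ⟨fun _ => 0, fun _ => 1, by simp, by simp, fun x => hX.elim x⟩
  have htrans : ∀ x y z, 0 < L x y → 0 < L y z → 0 < L x z := by
    intro x y z hxy hyz
    by_contra h
    have hxz : L x z = 0 := le_antisymm (not_lt.1 h) (h0 x z)
    have hzx : L z x = 1 := by have := h1 x z; linarith
    have := hc x y z
    unfold Cocycle at this
    rw [hxz, hzx] at this
    have h2 : 0 < L x y * L y z := by positivity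
    linarith
  -- By `htrans`, `0 < L x y` is a total preorder, and counting the elements below `x` ranks it.
  -- Strictness in `hlt` comes from `L x x = 1/2`.
  set rank : X → ℕ := fun x => (Finset.univ.filter fun y => 0 < L x y).card with hrank
  have hlt : ∀ x y, L y x = 0 → rank y < rank x := by
    intro x y hyx
    have hxy : 0 < L x y := by have := h1 x y; linarith
    apply Finset.card_lt_card
    rw [Finset.ssubset_iff_of_subset]
    · refine ⟨x, ?_, ?_⟩
      · have := h1 x x
        simp only [Finset.mem_filter, Finset.mem_univ, true_and]
        linarith
      · simp [hyx]
    · intro z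
      simp only [Finset.mem_filter, Finset.mem_univ, true_and]
      exact htrans x y z hxy
  have hle : ∀ x y, 0 < L y x → rank x ≤ rank y := by
    intro x y hyx
    apply Finset.card_le_card
    intro z
    simp only [Finset.mem_filter, Finset.mem_univ, true_and]
    exact htrans y x z hyx
  have hpos : ∀ x y, rank y ≤ rank x → 0 < L x y := by
    intro x y h
    refine lt_of_le_of_ne (h0 x y) fun h' => ?_
    have := hlt y x h'.symm
    omega
  -- One representative per rank fixes the scale of the weights; ratios to it are consistent by the
  -- cocycle identity.
  set rep : X → X := fun x => Function.invFun rank (rank x) with hrep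
  have hrepr : ∀ x, rank (rep x) = rank x := fun x => Function.invFun_eq ⟨x, rfl⟩
  refine ⟨rank, fun x => L x (rep x) / L (rep x) x, fun x => ?_, fun x y h => ?_, fun x y h => ?_⟩
  · exact div_pos (hpos _ _ (hrepr x).le) (hpos _ _ (hrepr x).ge)
  · have h2 : L y x = 0 := by
      by_contra h3
      have := hle x y (lt_of_le_of_ne (h0 y x) (Ne.symm h3))
      omega
    have := h1 x y
    linarith
  · have hr : rep x = rep y := by simp only [hrep, h]
    have p1 := hpos _ _ (hrepr x).ge
    have p2 := hpos _ _ (hrepr y).ge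
    have := hc x y (rep y)
    beta_reduce
    rw [hr] at p1 ⊢
    unfold Cocycle at this
    rw [mul_div_assoc', mul_div_assoc', div_eq_div_iff p2.ne' p1.ne']
    exact this.trans (by ring)

end Ranking

/-! ### Lexicographic weights and means -/

section LexWeight

variable {X : Type*}

/-- The total weight of the elements of `A` of rank `r`. -/
noncomputable def rankMass (rank : X → ℕ) (w : X → ℝ) (r : ℕ) (A : Finset X) : ℝ :=
  ∑ y ∈ A, if rank y = r then w y else 0

variable {rank : X → ℕ} {w : X → ℝ} {A B : Finset X}

theorem rankMass_nonneg (hw : ∀ x, 0 < w x) (r : ℕ) (A : Finset X) : 0 ≤ rankMass rank w r A :=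
  Finset.sum_nonneg fun y _ => by split_ifs <;> simp [(hw y).le]

theorem rankMass_pos (hw : ∀ x, 0 < w x) {x : X} (hx : x ∈ A) :
    0 < rankMass rank w (rank x) A :=
  Finset.sum_pos' (fun y _ => by split_ifs <;> simp [(hw y).le]) ⟨x, hx, by simp [hw x]⟩

theorem rankMass_sup_pos (hw : ∀ x, 0 < w x) (hA : A.Nonempty) :
    0 < rankMass rank w (A.sup rank) A := by
  obtain ⟨x, hx, h⟩ := Finset.exists_mem_eq_sup A hA rank
  rw [h]
  exact rankMass_pos hw hx

variable [DecidableEq X]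

/-- The probability vector on `A` that is proportional to `w` on the elements of top rank. -/
noncomputable def lexWeight (rank : X → ℕ) (w : X → ℝ) (A : Finset X) (x : X) : ℝ :=
  if x ∈ A ∧ rank x = A.sup rank then w x / rankMass rank w (A.sup rank) A else 0

theorem rankMass_insert {r : ℕ} {x : X} (hx : x ∉ A) (hr : rank x = r) :
    rankMass rank w r (insert x A) = w x + rankMass rank w r A := by
  rw [rankMass, Finset.sum_insert hx, if_pos hr, rankMass]

theorem lexWeight_of_notMem {x : X} (hx : x ∉ A) : lexWeight rank w A x = 0 := by
  simp [lexWeight, hx]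

theorem lexWeight_nonneg (hw : ∀ x, 0 < w x) (A : Finset X) (x : X) :
    0 ≤ lexWeight rank w A x := by
  unfold lexWeight
  split_ifs
  · exact div_nonneg (hw x).le (rankMass_nonneg hw _ _)
  · exact le_rfl

/-- Clears denominators with any upper bound `r` of the ranks, so that sets with different top ranks
can be compared. If `r` is not attained, both sides are zero. -/
theorem rankMass_mul_lexWeight (hw : ∀ x, 0 < w x) {r : ℕ} (hr : ∀ y ∈ A, rank y ≤ r) {x : X}
    (hx : x ∈ A) : rankMass rank w r A * lexWeight rank w A x = if rank x = r then w x else 0 := by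
  have hs : A.sup rank ≤ r := Finset.sup_le hr
  rcases hs.eq_or_lt with h | h
  · subst h
    have := (rankMass_sup_pos (rank := rank) hw ⟨x, hx⟩).ne'
    simp only [lexWeight, hx, true_and]
    split_ifs
    · field_simp
    · simp
  · have hlt : ∀ y ∈ A, rank y ≠ r := fun y hy => ((Finset.le_sup hy).trans_lt h).ne
    have h0 : rankMass rank w r A = 0 := Finset.sum_eq_zero fun y hy => if_neg (hlt y hy)
    rw [h0, if_neg (hlt x hx), zero_mul]

theorem sum_lexWeight (hw : ∀ x, 0 < w x) (hA : A.Nonempty) :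
    ∑ x ∈ A, lexWeight rank w A x = 1 := by
  have h := rankMass_sup_pos (rank := rank) hw hA
  apply mul_left_cancel₀ h.ne'
  rw [Finset.mul_sum, mul_one]
  exact Finset.sum_congr rfl fun x hx =>
    rankMass_mul_lexWeight hw (fun y hy => Finset.le_sup hy) hx

/-- Conditioning `lexWeight A` on a subset `B` gives `lexWeight B`. -/
theorem lexWeight_eq_mul (hw : ∀ x, 0 < w x) (hBA : B ⊆ A) {x : X} (hx : x ∈ B) :
    lexWeight rank w A x = (∑ y ∈ B, lexWeight rank w A y) * lexWeight rank w B x := by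
  have h := rankMass_sup_pos (rank := rank) hw ⟨x, hBA hx⟩
  have hA : ∀ y ∈ A, rank y ≤ A.sup rank := fun y hy => Finset.le_sup hy
  apply mul_left_cancel₀ h.ne'
  rw [rankMass_mul_lexWeight hw hA (hBA hx), ← mul_assoc, Finset.mul_sum,
    Finset.sum_congr rfl fun y hy => rankMass_mul_lexWeight hw hA (hBA hy)]
  exact (rankMass_mul_lexWeight hw (fun y hy => hA y (hBA hy)) hx).symm

/-- The average of `a` over `A` with weights `lexWeight A`. -/
noncomputable def lexMean {H : Type*} [AddCommGroup H] [Module ℝ H] (rank : X → ℕ) (w : X → ℝ)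
    (a : X → H) (A : Finset X) : H :=
  ∑ x ∈ A, lexWeight rank w A x • a x

variable {H : Type*} [AddCommGroup H] [Module ℝ H] {a : X → H}

theorem rankMass_smul_lexMean (hw : ∀ x, 0 < w x) {r : ℕ} (hr : ∀ y ∈ A, rank y ≤ r) :
    rankMass rank w r A • lexMean rank w a A =
      ∑ x ∈ A, (if rank x = r then w x else 0) • a x := by
  rw [lexMean, Finset.smul_sum]
  refine Finset.sum_congr rfl fun x hx => ?_
  rw [smul_smul, rankMass_mul_lexWeight hw hr hx]

theorem lexMean_singleton (hw : ∀ x, 0 < w x) (x : X) : lexMean rank w a {x} = a x := by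
  have := sum_lexWeight (rank := rank) hw (Finset.singleton_nonempty x)
  rw [Finset.sum_singleton] at this
  rw [lexMean, Finset.sum_singleton, this, one_smul]

theorem rankMass_smul_lexMean_insert (hw : ∀ x, 0 < w x) {r : ℕ} (hr : ∀ y ∈ A, rank y ≤ r)
    {x : X} (hx : x ∉ A) (hxr : rank x = r) :
    (w x + rankMass rank w r A) • lexMean rank w a (insert x A) =
      w x • a x + rankMass rank w r A • lexMean rank w a A := by
  rw [← rankMass_insert hx hxr, rankMass_smul_lexMean hw hr, rankMass_smul_lexMean hw,
    Finset.sum_insert hx, if_pos hxr]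
  intro y hy
  rcases Finset.mem_insert.1 hy with rfl | hy
  · exact hxr.le
  · exact hr y hy

/-- The coefficient is the total `lexWeight (A ∪ B)` of `A`; conditioning on each part yields its
own mean. -/
theorem finsetWeightedAveraging_lexMean (hw : ∀ x, 0 < w x) :
    FinsetWeightedAveraging (lexMean rank w a) := by
  intro A B hA hB hAB
  have key : ∀ C : Finset X, C ⊆ A ∪ B → ∑ x ∈ C, lexWeight rank w (A ∪ B) x • a x =
      (∑ x ∈ C, lexWeight rank w (A ∪ B) x) • lexMean rank w a C := by
    intro C hC
    rw [lexMean, Finset.smul_sum]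
    refine Finset.sum_congr rfl fun x hx => ?_
    rw [lexWeight_eq_mul hw hC hx, smul_smul]
  have hs := sum_lexWeight (rank := rank) hw (hA.mono (Finset.subset_union_left (s₂ := B)))
  rw [Finset.sum_union hAB] at hs
  have h0 : ∀ C : Finset X, 0 ≤ ∑ x ∈ C, lexWeight rank w (A ∪ B) x := fun C =>
    Finset.sum_nonneg fun x _ => lexWeight_nonneg hw _ x
  refine ⟨∑ x ∈ A, lexWeight rank w (A ∪ B) x, h0 A, by linarith [h0 B], ?_⟩
  rw [← eq_sub_iff_add_eq'.2 hs, lexMean, Finset.sum_union hAB,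
    key A Finset.subset_union_left, key B Finset.subset_union_right]

end LexWeight

/-! ### Pairs determine all finite sets -/

section Representation

variable {X H : Type*} [DecidableEq X] [AddCommGroup H] [Module ℝ H]

/-- A weighted averaging map that agrees with `lexMean` on pairs agrees with it on all nonempty
finite sets, if off each line through `F {x}` there is some `F {t}` with `t` of the rank of `x`. -/
theorem FinsetWeightedAveraging.eq_lexMean {F : Finset X → H} (hF : FinsetWeightedAveraging F)
    {rank : X → ℕ} {w : X → ℝ} (hw : ∀ x, 0 < w x)
    (hpair : ∀ x y, F {x, y} = lexMean rank w (fun x => F {x}) {x, y})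
    (hoff : ∀ x c, F {x} ≠ c → ∃ t, rank t = rank x ∧ Noncollinear (F {x}) c (F {t}))
    {A : Finset X} (hA : A.Nonempty) : F A = lexMean rank w (fun x => F {x}) A := by
  induction A using Finset.strongInduction with
  | H A ih =>
  set g := lexMean rank w (fun x => F {x}) with hg
  have hG : FinsetWeightedAveraging g := finsetWeightedAveraging_lexMean hw
  obtain ⟨x, hx, hxr⟩ := Finset.exists_mem_eq_sup A hA rank
  have hr : ∀ y ∈ A, rank y ≤ rank x := fun y hy => hxr ▸ Finset.le_sup hy
  rcases (A.erase x).eq_empty_or_nonempty with hC | hC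
  · have : A = {x} := by rw [← Finset.insert_erase hx, hC]; rfl
    rw [this, hg, lexMean_singleton hw]
  have ihe : ∀ y ∈ A, (A.erase y).Nonempty → F (A.erase y) = g (A.erase y) :=
    fun y hy h => ih _ (Finset.erase_ssubset hy) h
  have hsplit : ∀ y ∈ A, A = {y} ∪ A.erase y := fun y hy => by
    rw [← Finset.insert_eq, Finset.insert_erase hy]
  have hline : ∀ y ∈ A, (A.erase y).Nonempty → ∃ α β : ℝ,
      F A = α • F {y} + (1 - α) • g (A.erase y) ∧ g A = β • F {y} + (1 - β) • g (A.erase y) := by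
    intro y hy h
    obtain ⟨α, -, -, h1⟩ := hF {y} (A.erase y) (by simp) h (by simp)
    obtain ⟨β, -, -, h2⟩ := hG {y} (A.erase y) (by simp) h (by simp)
    rw [← hsplit y hy, ihe y hy h] at h1
    rw [← hsplit y hy, hg, lexMean_singleton hw] at h2
    exact ⟨α, β, h1, h2⟩
  obtain ⟨α, α', hα, hα'⟩ := hline x hx hC
  set c := g (A.erase x) with hc
  by_cases hxc : F {x} = c
  · rw [hα, hα', hxc]; module
  obtain ⟨t, htr, hnc⟩ := hoff x c hxc
  have htx : t ≠ x := by
    rintro rfl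
    exact hnc.rotate.rotate.ne rfl
  have hwx := hw x
  have hwt := hw t
  by_cases htA : t ∈ A
  -- Removing `t` gives a second line. The difference `F A - g A` is parallel to both `F {x} - c`
  -- and `F {t} - e`; expanding `c` and `e` over the common part `D` shows that these directions are
  -- independent.
  · have hxE : x ∈ A.erase t := Finset.mem_erase.2 ⟨htx.symm, hx⟩
    have htC : t ∈ A.erase x := Finset.mem_erase.2 ⟨htx, htA⟩
    obtain ⟨β, β', hβ, hβ'⟩ := hline t htA ⟨x, hxE⟩
    set D := (A.erase x).erase t with hD
    have hDr : ∀ y ∈ D, rank y ≤ rank x := fun y hy =>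
      hr y (Finset.mem_of_mem_erase (Finset.mem_of_mem_erase hy))
    have hCD : insert t D = A.erase x := Finset.insert_erase htC
    have hED : insert x D = A.erase t := by
      rw [hD, Finset.erase_right_comm, Finset.insert_erase hxE]
    have e1 := rankMass_smul_lexMean_insert (a := fun x => F {x}) hw hDr (by simp [hD]) htr
    have e2 := rankMass_smul_lexMean_insert (a := fun x => F {x}) (x := x) hw hDr
      (by simp [hD]) rfl
    rw [hCD, ← hg, ← hc] at e1
    rw [hED, ← hg] at e2
    have hm := rankMass_nonneg (rank := rank) hw (rank x) D
    set m := rankMass rank w (rank x) D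
    set e := g (A.erase t)
    have h0 : (α - α') • (F {x} - c) = (β - β') • (F {t} - e) := by
      linear_combination (norm := module) hα' - hα + hβ - hβ'
    have h1 := hnc ((w x + m) * (α - α') + (β - β') * w x)
      (-((w x + m) * (α - α')) + (β - β') * (w t + m))
      (-((β - β') * (w x + m + w t))) (by ring)
      (by linear_combination (norm := module) (w x + m) • h0 - (β - β') • e2 + (β - β') • e1)
    have h2 : β - β' = 0 := by
      have h3 := h1.2.2
      rw [neg_eq_zero] at h3
      exact (mul_eq_zero.1 h3).resolve_right (by positivity)
    rw [hβ, hβ', sub_eq_zero.1 h2]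
  -- For each `y ∈ A`, pairs and the induction hypothesis put `F B` and `g B` on one line through `g
  -- {y, t}` and `g (A.erase y)`.
  · set B := insert t A with hB
    have ep := rankMass_smul_lexMean_insert (a := fun x => F {x}) (A := {t}) (x := x)
      (r := rank x) hw (by simp [htr]) (by simpa using htx.symm) rfl
    rw [← hg, hg, lexMean_singleton hw, ← hg] at ep
    have hmt : rankMass rank w (rank x) {t} = w t := by simp [rankMass, htr]
    rw [hmt] at ep
    set p := g {x, t} with hp
    have hBline : ∀ y ∈ A, (A.erase y).Nonempty → ∃ u₁ u₂ : ℝ,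
        F B = u₁ • g {y, t} + (1 - u₁) • g (A.erase y) ∧
        g B = u₂ • g {y, t} + (1 - u₂) • g (A.erase y) := by
      intro y hy h
      have hBy : {y, t} ∪ A.erase y = B := by
        rw [hB, ← Finset.insert_erase hy]
        ext z
        simp
        tauto
      have hdis : Disjoint {y, t} (A.erase y) := by
        simp [htA]
      obtain ⟨l₁, -, -, h1⟩ := hF {y, t} (A.erase y) (by simp) h hdis
      obtain ⟨l₂, -, -, h2⟩ := hG {y, t} (A.erase y) (by simp) h hdis
      rw [hBy, ihe y hy h, hpair] at h1
      rw [hBy] at h2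
      exact ⟨l₁, l₂, h1, h2⟩
    obtain ⟨l₁, l₂, hl₁, hl₂⟩ := hBline x hx hC
    rw [← hc, ← hp] at hl₁ hl₂
    have hFB : F B = g B := by
      by_contra hne
      -- Two distinct points make all these lines coincide, so every `g {y, t}` lies on the line
      -- through `c` and `p`.
      have hs : ∀ y, ∃ s : ℝ, y ∈ A.erase x → g {y, t} - c = s • (p - c) := by
        intro y
        by_cases hy : y ∈ A.erase x
        · obtain ⟨hyx, hyA⟩ := Finset.mem_erase.1 hy
          obtain ⟨k₁, k₂, hk₁, hk₂⟩ := hBline y hyA ⟨x, Finset.mem_erase.2 ⟨hyx.symm, hx⟩⟩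
          set e := g (A.erase y)
          set q := g {y, t}
          have hk : k₁ - k₂ ≠ 0 := by
            intro h
            apply hne
            rw [hk₁, hk₂, sub_eq_zero.1 h]
          have h1 : (k₁ - k₂) • (q - e) = (l₁ - l₂) • (p - c) := by
            linear_combination (norm := module) hl₁ - hl₂ - hk₁ + hk₂
          have h2 : q - e = ((k₁ - k₂)⁻¹ * (l₁ - l₂)) • (p - c) := by
            rw [mul_smul, ← h1, smul_smul, inv_mul_cancel₀ hk, one_smul]
          refine ⟨l₂ + (1 - k₂) * ((k₁ - k₂)⁻¹ * (l₁ - l₂)), fun _ => ?_⟩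
          linear_combination (norm := module) hl₂ - hk₂ + (1 - k₂) • h2
        · exact ⟨0, fun h => absurd h hy⟩
      choose s hs using hs
      have hq : ∀ y ∈ A.erase x, ((w t + if rank y = rank x then w y else 0) * s y) • (p - c) =
          w t • (F {t} - c) + (if rank y = rank x then w y else 0) • F {y} -
            (if rank y = rank x then w y else 0) • c := by
        intro y hy
        have hyA := Finset.mem_of_mem_erase hy
        have hty : t ≠ y := fun h => htA (h ▸ hyA)
        have e1 := rankMass_smul_lexMean_insert (a := fun x => F {x}) (A := {y}) (x := t)
          (r := rank x) hw (by simpa using hr y hyA) (by simpa using hty) htr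
        rw [lexMean_singleton hw, Finset.pair_comm, ← hg] at e1
        have hmy : rankMass rank w (rank x) {y} = if rank y = rank x then w y else 0 := by
          simp [rankMass]
        rw [hmy] at e1
        rw [mul_smul, ← hs y hy]
        linear_combination (norm := module) e1
      -- The sum over `y` is `S • (p - c) = (N * w t) • (F {t} - c)`. As `p` mixes `F {x}` and `F
      -- {t}` with positive weights, this contradicts `hnc`.
      have hsum := Finset.sum_congr rfl hq
      have hmc := rankMass_smul_lexMean (a := fun x => F {x}) (A := A.erase x) (r := rank x) hw
        (fun y hy => hr y (Finset.mem_of_mem_erase hy))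
      rw [Finset.sum_sub_distrib, Finset.sum_add_distrib, ← hmc, ← Finset.sum_smul,
        ← Finset.sum_smul, ← Finset.sum_smul, Finset.sum_const, ← hg, ← hc, rankMass,
        add_sub_cancel_right, nsmul_eq_mul] at hsum
      set S := ∑ y ∈ A.erase x, (w t + if rank y = rank x then w y else 0) * s y
      have hcard : (0 : ℝ) < (A.erase x).card := by exact_mod_cast hC.card_pos
      set N : ℝ := ((A.erase x).card : ℝ)
      obtain ⟨h1, -, h3⟩ := hnc (S * w x) (N * w t * (w x + w t) - S * (w x + w t))
        (S * w t - N * w t * (w x + w t)) (by ring)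
        (by linear_combination (norm := module) (w x + w t) • hsum - S • ep)
      have hS : S = 0 := (mul_eq_zero.1 h1).resolve_right hwx.ne'
      rw [hS] at h3
      have : 0 < N * w t * (w x + w t) := by positivity
      linarith
    -- Coordinates of `F B = g B` in the triangle `F {x}`, `c`, `F {t}` give the positive factor `(w
    -- t + m) * (1 - l) = m`, and then `α = α'`.
    obtain ⟨l, -, -, hl⟩ := hF {t} A (by simp) hA (by simpa using htA)
    have eB := rankMass_smul_lexMean_insert (a := fun x => F {x}) hw hr htA htr
    rw [← hg, ← hB, ← hFB, hB, Finset.insert_eq, hl, hα, hα'] at eB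
    have hm := rankMass_pos (rank := rank) hw hx
    set m := rankMass rank w (rank x) A
    obtain ⟨h1, h2, -⟩ := hnc.coeff_eq (α := (w t + m) * (1 - l) * α)
      (β := (w t + m) * (1 - l) * (1 - α)) (γ := (w t + m) * l)
      (α' := m * α') (β' := m * (1 - α')) (γ' := w t) (by ring)
      (by linear_combination (norm := module) eB)
    have h3 : (w t + m) * (1 - l) = m := by linear_combination h1 + h2
    rw [h3] at h1
    rw [hα, hα', mul_left_cancel₀ hm.ne' h1]

end Representation

/-! ### The representation under strong richness -/

section Representation

variable {X H : Type*} [Finite X] [DecidableEq X] [AddCommGroup H] [Module ℝ H]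

/-- A strongly rich weighted averaging map is the mean of its values at singletons, with weights
given by a ranking of the signals and positive weights. -/
theorem FinsetWeightedAveraging.exists_lexMean {F : Finset X → H}
    (hF : FinsetWeightedAveraging F)
    (hr : ∀ x, ∃ y z, Noncollinear (F {x}) (F {y}) (F {z}) ∧
      (F {x, y} ≠ F {x} ∧ F {x, y} ≠ F {y}) ∧ (F {x, z} ≠ F {x} ∧ F {x, z} ≠ F {z})) :
    ∃ (rank : X → ℕ) (w : X → ℝ), (∀ x, 0 < w x) ∧
      ∀ A : Finset X, A.Nonempty → F A = lexMean rank w (fun x => F {x}) A := by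
  obtain ⟨l, hl⟩ := hF.exists_isPairWeight
  have htied : ∀ x y, F {x} ≠ F {y} → F {x, y} ≠ F {x} → F {x, y} ≠ F {y} →
      l x y ≠ 0 ∧ l y x ≠ 0 := by
    intro x y h h1 h2
    have hs := hl.add_swap x y h
    rw [hl.pair_eq x y h] at h1 h2
    constructor
    · intro h0
      rw [h0, zero_add] at hs
      exact h2 (by rw [h0, hs]; simp)
    · intro h0
      rw [h0, add_zero] at hs
      exact h1 (by rw [h0, hs]; simp)
  have hr' : ∀ x, ∃ y z, Noncollinear (F {x}) (F {y}) (F {z}) ∧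
      (l x y ≠ 0 ∧ l y x ≠ 0) ∧ (l x z ≠ 0 ∧ l z x ≠ 0) := by
    intro x
    obtain ⟨y, z, h, ⟨h1, h2⟩, h3, h4⟩ := hr x
    exact ⟨y, z, h, htied x y h.ne h1 h2, htied x z h.rotate.rotate.ne.symm h3 h4⟩
  obtain ⟨L, hL0, hL1, hLl, hLc⟩ := exists_cocycle_extension (a := fun x => F {x})
    hl.nonneg hl.add_swap (fun x y z h => hl.cocycle hF h) hr'
  obtain ⟨rank, w, hw, hlt, heq⟩ := exists_rank_weight hL0 hL1 hLc
  refine ⟨rank, w, hw, fun A hA => hF.eq_lexMean hw ?_ ?_ hA⟩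
  · have hle : ∀ x y, rank y ≤ rank x →
        F {x, y} = lexMean rank w (fun x => F {x}) {x, y} := by
      intro x y hxy
      by_cases hne : x = y
      · subst hne
        rw [Finset.pair_eq_singleton, lexMean_singleton hw]
      have hm := rankMass_smul_lexMean_insert (a := fun x => F {x}) (A := {y}) (x := x)
        (r := rank x) hw (by simpa using hxy) (by simpa using hne) rfl
      rw [lexMean_singleton hw] at hm
      have hmy := rankMass_nonneg (rank := rank) hw (rank x) {y}
      have hmy' : rankMass rank w (rank x) {y} = if rank y = rank x then w y else 0 := by
        simp [rankMass]
      set m := rankMass rank w (rank x) {y}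
      have hwx := hw x
      have hpos : w x + m ≠ 0 := by positivity
      apply smul_right_injective H hpos
      refine Eq.trans ?_ hm.symm
      beta_reduce
      by_cases hxy' : F {x} = F {y}
      · obtain ⟨k, -, -, h⟩ := hF {x} {y} (by simp) (by simp) (by simpa using hne)
        rw [Finset.insert_eq, h, hxy']
        module
      · have hs := hL1 x y
        rw [hl.pair_eq x y hxy', ← hLl x y hxy', ← hLl y x (Ne.symm hxy')]
        rcases hxy.eq_or_lt with h | h
        · have he := heq x y h.symm
          rw [if_pos h] at hmy'
          have h1 : (w x + m) * L x y = w x := by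
            rw [hmy']; linear_combination he + w x * hs
          have h2 : (w x + m) * L y x = m := by
            rw [hmy'] at h1 ⊢; linear_combination (w x + w y) * hs - h1
          rw [smul_add, smul_smul, smul_smul, h1, h2]
        · have h1 := hlt x y h
          rw [if_neg h.ne] at hmy'
          have h2 : L y x = 0 := by linarith
          rw [h1, h2, hmy']
          module
    intro x y
    rcases le_total (rank y) (rank x) with h | h
    · exact hle x y h
    · rw [Finset.pair_comm]; exact hle y x h
  · intro x c hxc
    obtain ⟨y, z, h, ⟨hy1, hy2⟩, hz1, hz2⟩ := hr' x
    -- Tied signals have equal rank, since unequal ranks give weights 1 and 0.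
    have hrk : ∀ y, F {x} ≠ F {y} → l x y ≠ 0 → l y x ≠ 0 → rank y = rank x := by
      intro y hne h1 h2
      have hs := hl.add_swap x y hne
      rw [← hLl x y hne] at h1 hs
      rw [← hLl y x hne.symm] at h2 hs
      rcases lt_trichotomy (rank y) (rank x) with h | h | h
      · have := hlt x y h
        exact absurd (by linarith) h2
      · exact h
      · have := hlt y x h
        exact absurd (by linarith) h1
    rcases h.off_line hxc with h' | h'
    · exact ⟨y, hrk y h.ne hy1 hy2, h'⟩
    · exact ⟨z, hrk z h.rotate.rotate.ne.symm hz1 hz2, h'⟩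

end Representation

/-! ### Finitely supported measures -/

section PointMass

variable {X : Type*} [Fintype X] {n : ℕ}

theorem sum_indicator_prod (B : Finset (Fin n)) (A : Finset X) (p : Fin n × X → ℝ) :
    ∑ i, ((B : Set (Fin n)) ×ˢ (A : Set X)).indicator p i = ∑ ω ∈ B, ∑ x ∈ A, p (ω, x) := by
  classical
  rw [← Finset.sum_product', ← Finset.coe_product]
  exact Finset.sum_indicator_subset _ (Finset.subset_univ _)

variable [MeasurableSpace X]

/-- The finitely supported measure on `Ω × X` with point masses `p`. -/
noncomputable def pointMassMeasure (p : Fin n × X → ℝ) : Measure (Fin n × X) :=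
  ∑ i, ENNReal.ofReal (p i) • Measure.dirac i

theorem pointMassMeasure_apply [DiscreteMeasurableSpace X] {p : Fin n × X → ℝ}
    (hp : ∀ i, 0 ≤ p i) (C : Set (Fin n × X)) :
    pointMassMeasure p C = ENNReal.ofReal (∑ i, C.indicator p i) := by
  classical
  rw [pointMassMeasure, Measure.finsetSum_apply,
    ENNReal.ofReal_sum_of_nonneg fun i _ => Set.indicator_nonneg (fun i _ => hp i) i]
  refine Finset.sum_congr rfl fun i _ => ?_
  rw [Measure.smul_apply, Measure.dirac_apply' _ (MeasurableSet.of_discrete), smul_eq_mul]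
  by_cases h : i ∈ C <;> simp [h]

end PointMass

/-! ### Conditional probability systems -/

section CPS

variable {X : Type*} [DecidableEq X] [MeasurableSpace X] {n : ℕ}

theorem BeliefFormationProcess.RationalizableByCPS.weightedAveraging [DiscreteMeasurableSpace X]
    {f : BeliefFormationProcess X n} (hf : f.RationalizableByCPS) :
    f.toAggregationRule.WeightedAveraging := by
  obtain ⟨P, hP, hfP⟩ := hf
  have hprob := hP.isProbabilityMeasure
  -- Since `P A` is carried by `Ω × A`, the set `{ω} × A` may be replaced by `{ω} × X`, which no
  -- longer depends on `A`.
  have hval : ∀ (A : NonemptyFinset X) (ω : Fin n),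
      f.toAggregationRule A ω = (P A).real ({ω} ×ˢ (Set.univ : Set X)) := by
    intro A ω
    have h := hfP A {ω}
    simp only [BeliefFormationProcess.prob, Finset.sum_singleton, Finset.coe_singleton] at h
    rw [h]
    have hnull : P A (Set.univ ×ˢ (A.1 : Set X))ᶜ = 0 := by
      rw [prob_compl_eq_zero_iff (MeasurableSet.univ.prod A.1.measurableSet)]
      exact hP.support A
    apply measureReal_congr
    have hae : ∀ᵐ i ∂(P A), i ∈ (Set.univ : Set (Fin n)) ×ˢ (A.1 : Set X) := hnull
    filter_upwards [hae] with i hi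
    have hi2 : i.2 ∈ (A.1 : Set X) := hi.2
    apply propext
    change (i.1 ∈ _ ∧ i.2 ∈ _) ↔ (i.1 ∈ _ ∧ i.2 ∈ _)
    simp only [hi2, Set.mem_univ]
  intro A B hAB
  refine ⟨(P (.union A B)).real (Set.univ ×ˢ (A.1 : Set X)),
    ⟨measureReal_nonneg, measureReal_le_one⟩, ?_⟩
  have hb : ∀ C : Set (Fin n × X), (P (.union A B)).real C =
      (P (.union A B)).real (Set.univ ×ˢ (A.1 : Set X)) * (P A).real C +
        (P (.union A B)).real (Set.univ ×ˢ (B.1 : Set X)) * (P B).real C := by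
    intro C
    have := hP.bayes A B hAB C
    simp only [Measure.real]
    rw [this, ENNReal.toReal_add, ENNReal.toReal_mul, ENNReal.toReal_mul]
    · exact ENNReal.mul_ne_top (measure_ne_top _ _) (measure_ne_top _ _)
    · exact ENNReal.mul_ne_top (measure_ne_top _ _) (measure_ne_top _ _)
  have h1 : (P (.union A B)).real (Set.univ ×ˢ (A.1 : Set X)) +
      (P (.union A B)).real (Set.univ ×ˢ (B.1 : Set X)) = 1 := by
    have := hb Set.univ
    simp only [probReal_univ, mul_one] at this
    exact this.symm
  ext ω
  simp only [Pi.add_apply, Pi.smul_apply, smul_eq_mul, hval]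
  rw [hb, ← h1]
  ring

variable [Fintype X]

/-- Bayes' rule and rationalization for the product of `lexWeight A` and the singleton beliefs. -/
theorem BeliefFormationProcess.rationalizableByCPS_of_lexMean [DiscreteMeasurableSpace X]
    {f : BeliefFormationProcess X n} {rank : X → ℕ} {w : X → ℝ} (hw : ∀ x, 0 < w x)
    (h : ∀ A : NonemptyFinset X, f.toAggregationRule A =
      lexMean rank w (fun x => f.toAggregationRule (.single x)) A.1) :
    f.RationalizableByCPS := by
  set a : X → Fin n → ℝ := fun x => f.toAggregationRule (.single x) with ha
  have ha0 : ∀ x ω, 0 ≤ a x ω := fun x ω => (f (.single x)).2.1 ω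
  have ha1 : ∀ x, ∑ ω, a x ω = 1 := fun x => (f (.single x)).2.2
  set p : Finset X → Fin n × X → ℝ := fun A i => lexWeight rank w A i.2 * a i.2 i.1 with hp
  have hp0 : ∀ A i, 0 ≤ p A i := fun A i => mul_nonneg (lexWeight_nonneg hw A i.2) (ha0 i.2 i.1)
  have hstrip : ∀ S A : Finset X, pointMassMeasure (p S) (Set.univ ×ˢ (A : Set X)) =
      ENNReal.ofReal (∑ x ∈ A, lexWeight rank w S x) := by
    intro S A
    rw [pointMassMeasure_apply (hp0 S), ← Finset.coe_univ, sum_indicator_prod, Finset.sum_comm]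
    congr 1
    refine Finset.sum_congr rfl fun x _ => ?_
    simp only [hp]
    rw [← Finset.mul_sum, ha1, mul_one]
  have huniv : ∀ A : NonemptyFinset X, pointMassMeasure (p A.1) Set.univ = 1 := by
    intro A
    have := hstrip A.1 Finset.univ
    rw [Finset.coe_univ, Set.univ_prod_univ, ← Finset.sum_subset (Finset.subset_univ A.1)
      fun x _ hx => lexWeight_of_notMem hx, sum_lexWeight hw A.2, ENNReal.ofReal_one] at this
    exact this
  refine ⟨fun A => pointMassMeasure (p A.1), ⟨fun A => ⟨huniv A⟩, fun A => ?_, ?_⟩, ?_⟩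
  · rw [hstrip, sum_lexWeight hw A.2, ENNReal.ofReal_one]
  · intro A B hAB C
    have hnn : ∀ S A : Finset X, 0 ≤ ∑ x ∈ A, lexWeight rank w S x := fun S A =>
      Finset.sum_nonneg fun x _ => lexWeight_nonneg hw S x
    have hC : ∀ A, 0 ≤ ∑ i, C.indicator (p A) i := fun A =>
      Finset.sum_nonneg fun i _ => Set.indicator_nonneg (fun i _ => hp0 A i) i
    rw [hstrip, hstrip, pointMassMeasure_apply (hp0 _), pointMassMeasure_apply (hp0 _),
      pointMassMeasure_apply (hp0 _), ← ENNReal.ofReal_mul (hnn _ _),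
      ← ENNReal.ofReal_mul (hnn _ _), ← ENNReal.ofReal_add (mul_nonneg (hnn _ _) (hC _))
      (mul_nonneg (hnn _ _) (hC _)), Finset.mul_sum, Finset.mul_sum, ← Finset.sum_add_distrib]
    congr 1
    refine Finset.sum_congr rfl fun i _ => ?_
    by_cases hi : i ∈ C
    · simp only [Set.indicator_of_mem hi, hp, NonemptyFinset.union]
      by_cases hA : i.2 ∈ A.1
      · have hB : i.2 ∉ B.1 := Finset.disjoint_left.1 hAB hA
        rw [lexWeight_of_notMem hB, lexWeight_eq_mul hw Finset.subset_union_left hA]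
        ring
      · rw [lexWeight_of_notMem hA]
        by_cases hB : i.2 ∈ B.1
        · rw [lexWeight_eq_mul hw Finset.subset_union_right hB]
          ring
        · rw [lexWeight_of_notMem hB, lexWeight_of_notMem (by simp [hA, hB])]
          ring
    · simp [Set.indicator_of_notMem hi]
  · intro A B
    have hnn : 0 ≤ ∑ ω ∈ B, ∑ x ∈ A.1, p A.1 (ω, x) :=
      Finset.sum_nonneg fun ω _ => Finset.sum_nonneg fun x _ => hp0 A.1 (ω, x)
    rw [Measure.real, pointMassMeasure_apply (hp0 _), sum_indicator_prod,
      ENNReal.toReal_ofReal hnn, BeliefFormationProcess.prob]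
    refine Finset.sum_congr rfl fun ω _ => ?_
    rw [h A, lexMean, Finset.sum_apply]
    rfl

end CPS

theorem proposition3 {X : Type*} [Finite X] [DecidableEq X] [MeasurableSpace X]
    [DiscreteMeasurableSpace X] {n : ℕ} (f : BeliefFormationProcess X n)
    (hf : f.toAggregationRule.StronglyRich) :
    f.RationalizableByCPS ↔ f.toAggregationRule.WeightedAveraging := by
  refine ⟨fun h => h.weightedAveraging, fun h => ?_⟩
  have := Fintype.ofFinite X
  -- The value 0 at the empty set is a dummy.
  set F : Finset X → Fin n → ℝ := fun A =>
    if hA : A.Nonempty then f.toAggregationRule ⟨A, hA⟩ else 0 with hF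
  have hFA : ∀ A : NonemptyFinset X, F A.1 = f.toAggregationRule A := fun A => dif_pos A.2
  have hFW : FinsetWeightedAveraging F := by
    intro A B hA hB hAB
    obtain ⟨l, ⟨h0, h1⟩, h2⟩ := h ⟨A, hA⟩ ⟨B, hB⟩ hAB
    refine ⟨l, h0, h1, ?_⟩
    rw [← hFA, ← hFA, ← hFA] at h2
    exact h2
  have hsingle : ∀ x, F {x} = f.toAggregationRule (.single x) := fun x => hFA (.single x)
  have hpair : ∀ x y, F {x, y} = f.toAggregationRule (.pair x y) := fun x y => hFA (.pair x y)
  obtain ⟨rank, w, hw, hrep⟩ := hFW.exists_lexMean (by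
    intro x
    obtain ⟨y, z, h1, h2, h3⟩ := hf x
    rw [← hpair] at h2 h3
    rw [← hsingle, ← hsingle, ← hsingle] at h1
    rw [← hsingle, ← hsingle] at h2 h3
    simp only [Set.mem_insert_iff, Set.mem_singleton_iff, not_or] at h2 h3
    exact ⟨y, z, .of_not_collinear h1, h2, h3⟩)
  refine BeliefFormationProcess.rationalizableByCPS_of_lexMean (rank := rank) hw fun A => ?_
  rw [← hFA, hrep A.1 A.2]
  simp only [hsingle]
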